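/- **Definitions.** Let $B$ be a real Banach space and $\alpha\ge 0$. A nonempty closed set $P\subset B$ is *$\alpha$-paraconvex* if for every open ball $D_r\subset B$ of radius $r>0$ one has $\operatorname{dist}(q,P)\le \alpha r$ for all $q\in\operatorname{conv}(P\cap D_r)$. For $m\ge1$ let $\Delta_m=\{t\in[0,1]^m:\sum_i t_i=1\}$, and for an $m$-tuple $z$ ($m\ge 2$) let $\partial_i z$ be the $(m-1)$-tuple obtained by omitting the $i$-th entry. A *convex metric structure* (in the sense of E. Michael) on a metric space $(E,\rho)$ consists of sets $M_m\subset E^m$ and maps $k_m:M_m\times \Delta_m\to E$, $m\ge1$, such that 1. $M_1=E$ and $k_1(x,1)=x$; 2. if $x\in M_m$, $m\ge2$, $1\le i\le m$, then $\partial_i x\in M_{m-1}$, and if $t\in\Delta_m$ has $t_i=0$, then $k_m(x,t)=k_{m-1}(\partial_i x,\partial_i t)$; 3. if $x\in M_m$, $m\ge2$, $1\le i<m$, $x_i=x_{i+1}$ and $t\in\Delta_m$, then $k_m(x,t)=k_{m-1}(\partial_{i+1} x,(t_1,\dots,t_{i-1},t_i+t_{i+1},t_{i+2},\dots,t_m))$;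 4. for each $x\in M_m$ the map $t\mapsto k_m(x,t)$ is continuous; 5. for each $\varepsilon>0$ there is a neighborhood $V$ of the diagonal in $E\times E$ such that for all $m$, all $x,y\in M_m$ with $(x_i,y_i)\in V$ for $i=1,\dots,m$, and all $t\in\Delta_m$, one has $\rho(k_m(x,t),k_m(y,t))<\varepsilon$. A set $A\subset E$ is *convex* with respect to this structure if $A^m\subset M_m$ and $k_m(A^m\times \Delta_m)\subset A$ for all $m\ge1$. **Corollary 2.6.** Let $0\le\alpha<\frac12$, let $Y$ be a subset of a real Banach space $B$ with the induced metric, let $X$ be a topological space, and let $f:Y\to X$ be a continuous surjection such that every point-inverse $f^{-1}(x)$, $x\in X$, is compact and $\alpha$-paraconvex in $B$, and such that the mapping $x\mapsto f^{-1}(x)$ is continuous with respect to the Hausdorff metric. Then $Y$ admits a convex metric structure with respect to which every point-inverse $f^{-1}(x)$, $x\in X$, is convex. -/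

import Mathlib

open Set Filter Topology

/-- A subset `P` of a normed space is `α`-paraconvex: it is nonempty and closed, and for every open
ball `D` of radius `r`, every point of the convex hull of `P ∩ D` is at distance at most `α * r`
from `P`. -/
def IsParaconvex {B : Type*} [NormedAddCommGroup B] [NormedSpace ℝ B] (α : ℝ) (P : Set B) : Prop :=
  P.Nonempty ∧ IsClosed P ∧
    ∀ (c : B) (r : ℝ), 0 < r → ∀ q ∈ convexHull ℝ (P ∩ Metric.ball c r), Metric.infDist q P ≤ α * r

/-- Continuity, with respect to the Hausdorff distance, of a set-valued mapping (used for mappings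
whose values are nonempty and compact, where the Hausdorff distance is a genuine metric). -/
def HausdorffContinuous {X B : Type*} [TopologicalSpace X] [PseudoMetricSpace B]
    (F : X → Set B) : Prop :=
  ∀ x : X, Tendsto (fun x' => Metric.hausdorffDist (F x') (F x)) (𝓝 x) (𝓝 0)

/-- A convex metric structure, in the sense of E. Michael, on a metric space `E`.

The domain `M_m ⊆ E ^ m` (`m ≥ 1`) of the `m`-ary convex combinations is `M n` with `m = n + 1`, and
`k n x t` is the convex combination of the points `x 0, …, x n` with the weights `t 0, …, t n`. It
is meaningful for `x ∈ M n` and `t` in the standard simplex; its other values are irrelevant, and no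
condition is put on them. -/
structure ConvexMetricStructure (E : Type*) [PseudoMetricSpace E] where
  /-- The tuples of points whose convex combinations are defined. -/
  M : ∀ n : ℕ, Set (Fin (n + 1) → E)
  /-- The convex combinations. -/
  k : ∀ n : ℕ, (Fin (n + 1) → E) → (Fin (n + 1) → ℝ) → E
  /-- Every point has its combinations defined, … -/
  one_mem : ∀ x : Fin 1 → E, x ∈ M 0
  /-- … and it is its own convex combination with weight `1`. -/
  one_eq : ∀ x ∈ M 0, ∀ t ∈ stdSimplex ℝ (Fin 1), k 0 x t = x 0
  /-- Omitting a point from an admissible tuple leaves an admissible tuple. -/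
  face_mem : ∀ (n : ℕ), ∀ x ∈ M (n + 1), ∀ i : Fin (n + 2), i.removeNth x ∈ M n
  /-- A point with weight `0` may be omitted. -/
  face_eq : ∀ (n : ℕ), ∀ x ∈ M (n + 1), ∀ i : Fin (n + 2), ∀ t ∈ stdSimplex ℝ (Fin (n + 2)),
    t i = 0 → k (n + 1) x t = k n (i.removeNth x) (i.removeNth t)
  /-- Two equal consecutive points may be merged, and their weights added. -/
  merge_eq : ∀ (n : ℕ), ∀ x ∈ M (n + 1), ∀ i : Fin (n + 1), x i.castSucc = x i.succ →
    ∀ t ∈ stdSimplex ℝ (Fin (n + 2)),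
      k (n + 1) x t = k n (i.succ.removeNth x)
        (Function.update (i.succ.removeNth t) i (t i.castSucc + t i.succ))
  /-- Convex combinations depend continuously on the weights. -/
  continuousOn_weights : ∀ (n : ℕ), ∀ x ∈ M n,
    ContinuousOn (k n x) (stdSimplex ℝ (Fin (n + 1)))
  /-- For every `ε > 0` there is a neighborhood `V` of the diagonal such that two combinations, with
  the same number of points and the same weights, of `V`-close points are `ε`-close. -/
  close : ∀ ε : ℝ, 0 < ε → ∃ V ∈ 𝓝ˢ (diagonal E), ∀ (n : ℕ), ∀ x ∈ M n, ∀ y ∈ M n,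
    (∀ i, (x i, y i) ∈ V) → ∀ t ∈ stdSimplex ℝ (Fin (n + 1)), dist (k n x t) (k n y t) < ε

/-- A set is convex with respect to a convex metric structure if all convex combinations of its
points are defined and belong to it. -/
def ConvexMetricStructure.IsConvex {E : Type*} [PseudoMetricSpace E]
    (S : ConvexMetricStructure E) (A : Set E) : Prop :=
  ∀ (n : ℕ) (x : Fin (n + 1) → E), (∀ i, x i ∈ A) →
    x ∈ S.M n ∧ ∀ t ∈ stdSimplex ℝ (Fin (n + 1)), S.k n x t ∈ A

/-!
Over the metric space of all nonempty compact `α`-paraconvex subsets `P` of a Banach space,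
Michael's selection theorem for paraconvex-valued mappings provides retractions `p ↦ R (P, p)` of
the whole space onto `P` which are jointly continuous in `P` and `p`: they are a selection of the
mapping which is `{p}` where `p ∈ P` and `P` elsewhere. Pulled back along `x ↦ f ⁻¹' {x}`, they
retract the space onto the fibres of `f`, and the combination of points of one fibre is the
retraction of their affine combination. Axiom 5 holds because the convex hulls of the fibres near a
given one lie near a compact set, where a jointly continuous map is uniformly continuous. If the
ambient space is not complete, all this takes place in its completion, where compact paraconvex sets
remain paraconvex.
-/

open Metric TopologicalSpace UniformSpace

section Hemicontinuity

variable {Z M : Type*} [TopologicalSpace Z]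

theorem upperSemicontinuousAt_infDist [PseudoMetricSpace M] {Φ : Z → Set M} {z : Z}
    (hΦ : LowerHemicontinuousAt Φ z) (hne : (Φ z).Nonempty) (x : M) :
    UpperSemicontinuousAt (fun z' => infDist x (Φ z')) z := by
  intro r hr
  obtain ⟨y, hy, hxy⟩ := (infDist_lt_iff hne).1 hr
  filter_upwards [lowerHemicontinuousAt_iff.1 hΦ (ball x r) isOpen_ball ⟨y, hy, mem_ball'.2 hxy⟩]
    with z' ⟨y', hy', hxy'⟩
  exact (infDist_le_dist_of_mem hy').trans_lt (mem_ball'.1 hxy')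

theorem lowerHemicontinuous_sep_imp_eq [TopologicalSpace M] {Φ : Z → Set M}
    (hΦ : LowerHemicontinuous Φ) {C : Set Z} (hC : IsClosed C) {g : Z → M} (hg : ContinuousOn g C)
    (hgΦ : ∀ z ∈ C, g z ∈ Φ z) :
    LowerHemicontinuous fun z => {y ∈ Φ z | z ∈ C → y = g z} := by
  refine fun z => lowerHemicontinuousAt_iff.2 fun u hu ⟨y, ⟨hyΦ, hyg⟩, hyu⟩ => ?_
  have hgu : ∀ᶠ z' in 𝓝 z, z' ∈ C → g z' ∈ u := by
    by_cases hz : z ∈ C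
    · exact eventually_nhdsWithin_iff.1 ((hg z hz).eventually (hu.mem_nhds (hyg hz ▸ hyu)))
    · filter_upwards [hC.isOpen_compl.mem_nhds hz] with z' hz' hz'C using absurd hz'C hz'
  filter_upwards [lowerHemicontinuousAt_iff.1 (hΦ z) u hu ⟨y, hyΦ, hyu⟩, hgu]
    with z' ⟨y', hy', hy'u⟩ hgu'
  by_cases hz' : z' ∈ C
  · exact ⟨g z', ⟨hgΦ z' hz', fun _ => rfl⟩, hgu' hz'⟩
  · exact ⟨y', ⟨hy', fun h => absurd h hz'⟩, hy'u⟩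

theorem isClosed_setOf_mem_nonemptyCompacts [MetricSpace M] :
    IsClosed {z : NonemptyCompacts M × M | z.2 ∈ z.1} := by
  have hmem : ∀ z : NonemptyCompacts M × M, z.2 ∈ z.1 ↔ infDist z.2 (z.1 : Set M) = 0 := fun z =>
    z.1.isCompact.isClosed.mem_iff_infDist_zero z.1.nonempty
  have hinfDist := (lipschitz_infDist (α := M)).continuous.comp continuous_swap
  simp only [hmem]
  exact isClosed_eq hinfDist continuous_const

theorem HausdorffContinuous.continuous_nonemptyCompacts [MetricSpace M] {F : Z → NonemptyCompacts M}
    (hF : HausdorffContinuous fun z => (F z : Set M)) : Continuous F :=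
  continuous_iff_continuousAt.2 fun z => tendsto_iff_dist_tendsto_zero.2 (hF z)

theorem HausdorffContinuous.image_isometry {M' : Type*} [PseudoMetricSpace M] [PseudoMetricSpace M']
    {F : Z → Set M} (hF : HausdorffContinuous F) {i : M → M'} (hi : Isometry i) :
    HausdorffContinuous fun z => i '' F z := by
  intro z
  simpa only [hausdorffDist_image hi] using hF z

end Hemicontinuity

namespace IsParaconvex

variable {B : Type*} [NormedAddCommGroup B] [NormedSpace ℝ B] {α : ℝ} {P : Set B}

theorem nonneg (hP : IsParaconvex α P) : 0 ≤ α := by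
  obtain ⟨p, hp⟩ := hP.1
  simpa only [mul_one] using infDist_nonneg.trans
    (hP.2.2 p 1 one_pos p (subset_convexHull ℝ _ ⟨hp, mem_ball_self one_pos⟩))

theorem singleton (hα : 0 ≤ α) (x : B) : IsParaconvex α ({x} : Set B) := by
  refine ⟨singleton_nonempty x, isClosed_singleton, fun c r hr q hq => ?_⟩
  have hqx : q ∈ ({x} : Set B) := convexHull_min inter_subset_left (convex_singleton x) hq
  rw [infDist_zero_of_mem hqx]
  positivity

theorem sep_imp_eq (hP : IsParaconvex α P) {p : Prop} {x : B} (hx : p → x ∈ P) :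
    IsParaconvex α {y ∈ P | p → y = x} := by
  by_cases hp : p
  · have : {y ∈ P | p → y = x} = {x} := by
      ext y
      exact ⟨fun hy => hy.2 hp, fun hy => ⟨mem_singleton_iff.1 hy ▸ hx hp, fun _ => hy⟩⟩
    rw [this]
    exact singleton hP.nonneg x
  · simpa only [hp, false_imp_iff, and_true, ofPred_mem_eq] using hP

theorem infDist_lt (hP : IsParaconvex α P) {c : B} {r δ : ℝ} (hr : 0 < r) (hδ : 0 < δ) {q : B}
    (hq : q ∈ convexHull ℝ ({y | infDist y P < δ} ∩ ball c r)) :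
    infDist q P < δ + α * (r + δ) := by
  have hsub : {y | infDist y P < δ} ∩ ball c r ⊆
      thickening δ (convexHull ℝ (P ∩ ball c (r + δ))) := by
    rintro y ⟨hy, hyc⟩
    obtain ⟨p, hp, hyp⟩ := (infDist_lt_iff hP.1).1 hy
    refine mem_thickening_iff.2 ⟨p, subset_convexHull ℝ _ ⟨hp, ?_⟩, hyp⟩
    rw [mem_ball] at hyc ⊢
    linarith [dist_triangle_left p c y]
  obtain ⟨p, hp, hqp⟩ := mem_thickening_iff.1
    (convexHull_min hsub ((convex_convexHull ℝ _).thickening δ) hq)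
  linarith [hP.2.2 c (r + δ) (by linarith) p hp, infDist_le_infDist_add_dist (s := P) (x := q)
    (y := p)]

theorem image_of_denseRange {B' : Type*} [NormedAddCommGroup B'] [NormedSpace ℝ B']
    (hP : IsParaconvex α P) (L : B →ₗᵢ[ℝ] B') (hL : DenseRange L) (hLP : IsClosed (L '' P)) :
    IsParaconvex α (L '' P) := by
  refine ⟨hP.1.image L, hLP, fun c r hr q hq => ?_⟩
  have hlarger : ∀ ε > 0, infDist q (L '' P) ≤ α * (r + ε) := by
    intro ε hε
    obtain ⟨b, hb⟩ := hL.exists_dist_lt c hε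
    have hsub : L '' P ∩ ball c r ⊆ L '' (P ∩ ball b (r + ε)) := by
      rintro _ ⟨⟨p, hp, rfl⟩, hpc⟩
      refine ⟨p, ⟨hp, ?_⟩, rfl⟩
      rw [mem_ball] at hpc ⊢
      linarith [dist_triangle (L p) c (L b), L.dist_map p b]
    have hq' : q ∈ L '' convexHull ℝ (P ∩ ball b (r + ε)) :=
      (L.toLinearMap.image_convexHull _).symm ▸ convexHull_mono hsub hq
    obtain ⟨p, hp, rfl⟩ := hq'
    rw [infDist_image L.isometry]
    exact hP.2.2 b (r + ε) (by positivity) p hp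
  have hlim : Tendsto (fun ε => α * (r + ε)) (𝓝[>] 0) (𝓝 (α * r)) := by
    refine tendsto_nhdsWithin_of_tendsto_nhds (Continuous.tendsto' (by fun_prop) _ _ ?_)
    rw [add_zero]
  exact ge_of_tendsto hlim (eventually_nhdsWithin_of_forall hlarger)

end IsParaconvex

section Selection

variable {Z B : Type*} [TopologicalSpace Z]

theorem exists_continuousMap_tendsto_of_le_geometric [PseudoMetricSpace B] [CompleteSpace B]
    (u : ℕ → C(Z, B)) (r : C(Z, ℝ)) {β : ℝ} (hβ0 : 0 ≤ β) (hβ1 : β < 1)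
    (hu : ∀ n z, dist (u n z) (u (n + 1) z) ≤ r z * β ^ n) :
    ∃ s : C(Z, B), ∀ z, Tendsto (fun n => u n z) atTop (𝓝 (s z)) := by
  choose s hs using fun z => cauchySeq_tendsto_of_complete
    (cauchySeq_of_le_geometric β (r z) hβ1 fun n => hu n z)
  have htail : ∀ z n, dist (u n z) (s z) ≤ r z * β ^ n / (1 - β) := fun z =>
    dist_le_of_le_geometric_of_tendsto β (r z) hβ1 (fun n => hu n z) (hs z)
  have hunif : TendstoLocallyUniformly (fun n z => u n z) s atTop := by
    rw [tendstoLocallyUniformly_iff]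
    intro ε hε z
    have hbound : Tendsto (fun n : ℕ => (r z + 1) * β ^ n / (1 - β)) atTop (𝓝 0) := by
      simpa only [mul_zero, zero_div] using
        ((tendsto_pow_atTop_nhds_zero_of_lt_one hβ0 hβ1).const_mul (r z + 1)).div_const (1 - β)
    refine ⟨{z' | r z' < r z + 1},
      r.continuous.continuousAt.eventually_lt continuousAt_const (lt_add_one _), ?_⟩
    filter_upwards [hbound.eventually_lt_const hε] with n hn z' (hz' : r z' < r z + 1)
    rw [dist_comm]
    refine (htail z' n).trans_lt (lt_of_le_of_lt ?_ hn)
    have : 0 < 1 - β := sub_pos.2 hβ1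
    gcongr
  exact ⟨⟨s, hunif.continuous (Frequently.of_forall fun n => (u n).continuous)⟩, hs⟩

variable [NormalSpace Z] [ParacompactSpace Z] {Φ : Z → Set B}

theorem exists_continuousMap_infDist_lt [PseudoMetricSpace B] (hΦ : LowerHemicontinuous Φ)
    (hne : ∀ z, (Φ z).Nonempty) (x : B) : ∃ r : C(Z, ℝ), ∀ z, infDist x (Φ z) < r z :=
  exists_continuous_forall_mem_convex_of_local_const (fun _ => convex_Ioi _) fun z =>
    ⟨infDist x (Φ z) + 1,
      upperSemicontinuousAt_infDist (hΦ z) (hne z) x _ (lt_add_one _)⟩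

variable [NormedAddCommGroup B] [NormedSpace ℝ B] {α : ℝ}

theorem exists_better_approximate_selection {β : ℝ} (hαβ : α < β) (hβ : β ≤ 1)
    (hpara : ∀ z, IsParaconvex α (Φ z)) (hΦ : LowerHemicontinuous Φ) (g : C(Z, B)) (r : C(Z, ℝ))
    (hg : ∀ z, infDist (g z) (Φ z) < r z) :
    ∃ g' : C(Z, B), ∀ z, dist (g z) (g' z) < r z ∧ infDist (g' z) (Φ z) < β * r z := by
  have hr : ∀ z, 0 < r z := fun z => infDist_nonneg.trans_lt (hg z)
  -- `η + α (1 + η) ≤ β`, so that `IsParaconvex.infDist_lt` with `δ = η r` gives the bound `β r`.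
  set η : ℝ := (β - α) / 2 with hη
  have hη0 : 0 < η := half_pos (sub_pos.2 hαβ)
  have hlocal : ∀ z, ∃ c, ∀ᶠ z' in 𝓝 z,
      c ∈ convexHull ℝ ({y | infDist y (Φ z') < η * r z'} ∩ ball (g z') (r z')) := by
    intro z
    obtain ⟨c, hc, hcz⟩ := (infDist_lt_iff (hpara z).1).1 (hg z)
    have hball : ∀ᶠ z' in 𝓝 z, c ∈ ball (g z') (r z') :=
      (Continuous.continuousAt (by fun_prop)).eventually_lt r.continuous.continuousAt
        (dist_comm c (g z) ▸ hcz)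
    have hhalf : ∀ᶠ z' in 𝓝 z, r z / 2 < r z' :=
      continuousAt_const.eventually_lt r.continuous.continuousAt (half_lt_self (hr z))
    have hnear : ∀ᶠ z' in 𝓝 z, infDist c (Φ z') < η * (r z / 2) :=
      upperSemicontinuousAt_infDist (hΦ z) (hpara z).1 c _
        ((infDist_zero_of_mem hc).trans_lt (mul_pos hη0 (half_pos (hr z))))
    refine ⟨c, ?_⟩
    filter_upwards [hball, hhalf, hnear] with z' hball hhalf hnear
    exact subset_convexHull ℝ _ ⟨hnear.trans (mul_lt_mul_of_pos_left hhalf hη0), hball⟩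
  obtain ⟨g', hg'⟩ :=
    exists_continuous_forall_mem_convex_of_local_const (fun _ => convex_convexHull ℝ _) hlocal
  refine ⟨g', fun z => ⟨?_, ?_⟩⟩
  · exact mem_ball'.1 (convexHull_min inter_subset_right (convex_ball (g z) (r z)) (hg' z))
  · refine ((hpara z).infDist_lt (hr z) (mul_pos hη0 (hr z)) (hg' z)).trans_le ?_
    have hηβ : η + α * (1 + η) ≤ β := by
      nlinarith
    nlinarith [mul_le_mul_of_nonneg_right hηβ (hr z).le]

theorem exists_approximate_selections_seq {β : ℝ} (hαβ : α < β) (hβ : β ≤ 1)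
    (hpara : ∀ z, IsParaconvex α (Φ z)) (hΦ : LowerHemicontinuous Φ) :
    ∃ (u : ℕ → C(Z, B)) (r : C(Z, ℝ)), ∀ n z,
      dist (u n z) (u (n + 1) z) ≤ r z * β ^ n ∧ infDist (u n z) (Φ z) ≤ r z * β ^ n := by
  obtain ⟨r, hr⟩ := exists_continuousMap_infDist_lt hΦ (fun z => (hpara z).1) 0
  have himprove : ∀ (n : ℕ) (v : C(Z, B)), ∃ v' : C(Z, B),
      (∀ z, infDist (v z) (Φ z) < r z * β ^ n) →
        ∀ z, dist (v z) (v' z) < r z * β ^ n ∧ infDist (v' z) (Φ z) < r z * β ^ (n + 1) := by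
    intro n v
    by_cases hv : ∀ z, infDist (v z) (Φ z) < r z * β ^ n
    · obtain ⟨v', hv'⟩ := exists_better_approximate_selection hαβ hβ hpara hΦ v
        ⟨fun z => r z * β ^ n, by fun_prop⟩ hv
      refine ⟨v', fun _ z => ⟨(hv' z).1, (hv' z).2.trans_eq ?_⟩⟩
      change β * (r z * β ^ n) = r z * β ^ (n + 1)
      ring
    · exact ⟨v, fun h => absurd h hv⟩
  choose next hnext using himprove
  let u : ℕ → C(Z, B) := fun n => Nat.rec 0 next n
  have hu : ∀ n z, infDist (u n z) (Φ z) < r z * β ^ n := by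
    intro n
    induction n with
    | zero => exact fun z => (hr z).trans_eq (by rw [pow_zero, mul_one])
    | succ n ih => exact fun z => (hnext n (u n) ih z).2
  exact ⟨u, r, fun n z => ⟨(hnext n (u n) (hu n) z).1.le, (hu n z).le⟩⟩

variable [CompleteSpace B]

theorem exists_continuous_selection_of_isParaconvex (hα : α < 1)
    (hpara : ∀ z, IsParaconvex α (Φ z)) (hΦ : LowerHemicontinuous Φ) :
    ∃ s : C(Z, B), ∀ z, s z ∈ Φ z := by
  obtain ⟨β, hαβ, hβ1⟩ := exists_between (max_lt hα one_pos)
  obtain ⟨hαβ, hβ0⟩ := max_lt_iff.1 hαβ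
  obtain ⟨u, r, hu⟩ := exists_approximate_selections_seq hαβ hβ1.le hpara hΦ
  obtain ⟨s, hs⟩ :=
    exists_continuousMap_tendsto_of_le_geometric u r hβ0.le hβ1 fun n z => (hu n z).1
  refine ⟨s, fun z => ((hpara z).2.1.mem_iff_infDist_zero (hpara z).1).2 ?_⟩
  have hlim : Tendsto (fun n => infDist (u n z) (Φ z)) atTop (𝓝 (infDist (s z) (Φ z))) :=
    ((continuous_infDist_pt (Φ z)).tendsto (s z)).comp (hs z)
  have hbound : Tendsto (fun n : ℕ => r z * β ^ n) atTop (𝓝 0) := by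
    simpa only [mul_zero] using (tendsto_pow_atTop_nhds_zero_of_lt_one hβ0.le hβ1).const_mul (r z)
  exact tendsto_nhds_unique hlim
    (squeeze_zero (fun _ => infDist_nonneg) (fun n => (hu n z).2) hbound)

theorem exists_continuous_selection_eqOn_of_isParaconvex (hα : α < 1)
    (hpara : ∀ z, IsParaconvex α (Φ z)) (hΦ : LowerHemicontinuous Φ) {C : Set Z} (hC : IsClosed C)
    {g : Z → B} (hg : ContinuousOn g C) (hgΦ : ∀ z ∈ C, g z ∈ Φ z) :
    ∃ s : C(Z, B), (∀ z, s z ∈ Φ z) ∧ EqOn s g C := by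
  obtain ⟨s, hs⟩ := exists_continuous_selection_of_isParaconvex hα
    (fun z => (hpara z).sep_imp_eq (hgΦ z)) (lowerHemicontinuous_sep_imp_eq hΦ hC hg hgΦ)
  exact ⟨s, fun z => (hs z).1, fun z => (hs z).2⟩

end Selection

theorem exists_continuous_retraction_onto_isParaconvex {B : Type*} [NormedAddCommGroup B]
    [NormedSpace ℝ B] [CompleteSpace B] {α : ℝ} (hα : α < 1) :
    ∃ R : C({P : NonemptyCompacts B // IsParaconvex α (P : Set B)} × B, B),
      ∀ P p, R (P, p) ∈ P.1 ∧ (p ∈ P.1 → R (P, p) = p) := by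
  have hval : Continuous
      fun z : {P : NonemptyCompacts B // IsParaconvex α (P : Set B)} × B => z.1.1 := by fun_prop
  obtain ⟨R, hRmem, hReq⟩ := exists_continuous_selection_eqOn_of_isParaconvex hα
    (fun z : {P : NonemptyCompacts B // IsParaconvex α (P : Set B)} × B => z.1.2)
    (lowerHemicontinuous_iff_isOpen_inter_nonempty.2 fun u hu =>
      (NonemptyCompacts.isOpen_inter_nonempty_of_isOpen hu).preimage hval)
    (isClosed_setOf_mem_nonemptyCompacts.preimage (hval.prodMk continuous_snd))
    continuous_snd.continuousOn fun _ hz => hz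
  exact ⟨R, fun P p => ⟨hRmem (P, p), fun hp => hReq hp⟩⟩

/-- A jointly continuous family of retractions of a space `B`, into which `Y` is mapped by `e`, onto
the fibres of `f : Y → X`; the value at `x : X` and `p : B` is a point of the fibre of `x`. -/
structure FiberwiseRetraction {X Y B : Type*} [TopologicalSpace X] [TopologicalSpace Y]
    [TopologicalSpace B] (f : Y → X) (e : Y → B) where
  toFun : X → B → Y
  continuous_uncurry : Continuous (Function.uncurry toFun)
  map_apply : ∀ x p, f (toFun x p) = x
  apply_self : ∀ y, toFun (f y) (e y) = y

section FiberMapping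

variable {X Y B : Type*} [TopologicalSpace X] [TopologicalSpace Y] {f : Y → X} {e : Y → B}

theorem isProperMap_of_continuous_fiber [TopologicalSpace B] (hf : Continuous f)
    (he : IsInducing e) {F : X → NonemptyCompacts B} (hF : Continuous F)
    (hFe : ∀ x, (F x : Set B) = e '' (f ⁻¹' {x})) : IsProperMap f := by
  refine isProperMap_iff_isClosedMap_and_compact_fibers.2 ⟨hf, ?_, fun x => ?_⟩
  · refine isClosedMap_iff_upperHemicontinuous.2
      (upperHemicontinuous_iff_isOpen_preimage_Iic.2 fun u hu => ?_)
    obtain ⟨v, hv, rfl⟩ := he.isOpen_iff.1 hu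
    convert! (NonemptyCompacts.isOpen_subsets_of_isOpen hv).preimage hF using 1
    ext x
    simp only [mem_preimage, mem_Iic, mem_ofPred_eq, hFe, image_subset_iff]
  · rw [he.isCompact_iff, ← hFe]
    exact (F x).isCompact

theorem exists_fiberwiseRetraction [NormedAddCommGroup B] [NormedSpace ℝ B] [CompleteSpace B]
    {α : ℝ} (hα : α < 1) (he : IsEmbedding e) {F : X → NonemptyCompacts B} (hF : Continuous F)
    (hpara : ∀ x, IsParaconvex α (F x : Set B)) (hFe : ∀ x, (F x : Set B) = e '' (f ⁻¹' {x})) :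
    Nonempty (FiberwiseRetraction f e) := by
  obtain ⟨R, hR⟩ := exists_continuous_retraction_onto_isParaconvex (B := B) hα
  let G : X × B → B := fun z => R (⟨F z.1, hpara z.1⟩, z.2)
  have hG : Continuous G := by fun_prop
  have hGmem : ∀ x p, G (x, p) ∈ e '' (f ⁻¹' {x}) := fun x p => hFe x ▸ (hR ⟨F x, hpara x⟩ p).1
  choose k hkf hkG using hGmem
  refine ⟨⟨k, he.continuous_iff.2 ?_, hkf, fun y => he.injective ?_⟩⟩
  · exact hG.congr fun z => (hkG z.1 z.2).symm
  · have hy : e y ∈ (F (f y) : Set B) := hFe (f y) ▸ mem_image_of_mem e rfl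
    rw [hkG]
    exact (hR ⟨F (f y), hpara (f y)⟩ (e y)).2 hy

end FiberMapping

section WeightedSums

variable {R B : Type*} {n : ℕ}

theorem sum_smul_removeNth [Semiring R] [AddCommMonoid B] [Module R B] (x : Fin (n + 2) → B)
    (t : Fin (n + 2) → R) (i : Fin (n + 2)) (hi : t i = 0) :
    ∑ j, i.removeNth t j • i.removeNth x j = ∑ j, t j • x j := by
  simp only [Fin.sum_univ_succAbove _ i, hi, zero_smul, zero_add, Fin.removeNth_apply]

theorem sum_smul_merge [Semiring R] [AddCommMonoid B] [Module R B] (x : Fin (n + 2) → B)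
    (t : Fin (n + 2) → R) (i : Fin (n + 1)) (hi : x i.castSucc = x i.succ) :
    ∑ j, Function.update (i.succ.removeNth t) i (t i.castSucc + t i.succ) j • i.succ.removeNth x j
      = ∑ j, t j • x j := by
  have hi' : i.succ.succAbove i = i.castSucc :=
    Fin.succAbove_of_castSucc_lt _ _ Fin.castSucc_lt_succ
  have hterm : ∀ j, Function.update (i.succ.removeNth t) i (t i.castSucc + t i.succ) j •
      i.succ.removeNth x j = t (i.succ.succAbove j) • x (i.succ.succAbove j) +
        if j = i then t i.succ • x i.succ else 0 := by
    intro j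
    rcases eq_or_ne j i with rfl | hj
    · simp [Fin.removeNth, hi', hi, add_smul]
    · simp [Fin.removeNth, hj]
  rw [Finset.sum_congr rfl fun j _ => hterm j, Finset.sum_add_distrib,
    Fin.sum_univ_succAbove _ i.succ, add_comm, Finset.sum_ite_eq' Finset.univ i]
  simp only [Finset.mem_univ, if_true]

theorem dist_sum_smul_lt [SeminormedAddCommGroup B] [NormedSpace ℝ B] {ι : Type*} [Fintype ι]
    {x y : ι → B} {t : ι → ℝ} (ht : t ∈ stdSimplex ℝ ι) {δ : ℝ} (h : ∀ i, dist (x i) (y i) < δ) :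
    dist (∑ i, t i • x i) (∑ i, t i • y i) < δ := by
  have hmem : ∑ i, t i • (x i - y i) ∈ ball (0 : B) δ :=
    (convex_ball (0 : B) δ).sum_mem (fun i _ => ht.1 i) ht.2 fun i _ => by
      rw [mem_ball_zero_iff, ← dist_eq_norm]
      exact h i
  simpa only [smul_sub, Finset.sum_sub_distrib, mem_ball_zero_iff, ← dist_eq_norm] using hmem

end WeightedSums

section UniformContinuity

variable {X : Type*} [TopologicalSpace X]

theorem exists_dist_lt_near_isCompact {M N : Type*} [PseudoMetricSpace M] [PseudoMetricSpace N]
    {G : X × M → N} (hG : Continuous G) {K : Set M} (hK : IsCompact K) (a : X) {ε : ℝ}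
    (hε : 0 < ε) :
    ∃ U ∈ 𝓝 a, ∃ δ > 0, ∀ b ∈ U, ∀ c ∈ U, ∀ p ∈ thickening δ K, ∀ q, dist p q < δ →
      dist (G (b, p)) (G (c, q)) < ε := by
  let W : Set ((X × X) × M × M) := {w | dist (G (w.1.1, w.2.1)) (G (w.1.2, w.2.2)) < ε}
  have hW : IsOpen W := isOpen_lt (by fun_prop) continuous_const
  have hKdiag : IsCompact ((fun p => (p, p)) '' K) := hK.image (by fun_prop)
  have hdiag : {(a, a)} ×ˢ ((fun p => (p, p)) '' K) ⊆ W := by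
    rintro ⟨_, _⟩ ⟨rfl, p, -, rfl⟩
    simpa [W] using hε
  obtain ⟨u, v, hu, hv, hau, hKv, huv⟩ :=
    generalized_tube_lemma isCompact_singleton hKdiag hW hdiag
  obtain ⟨U, hU, hUu⟩ : ∃ U ∈ 𝓝 a, U ×ˢ U ⊆ u := by
    have := hu.mem_nhds (singleton_subset_iff.1 hau)
    rwa [nhds_prod_eq, mem_prod_self_iff] at this
  obtain ⟨δ, hδ, hδv⟩ := hKdiag.exists_thickening_subset_open hv hKv
  refine ⟨U, hU, δ / 2, half_pos hδ, fun b hb c hc p hp q hpq => ?_⟩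
  suffices (p, q) ∈ thickening δ ((fun p => (p, p)) '' K) from
    huv (⟨hUu ⟨hb, hc⟩, hδv this⟩ : ((b, c), (p, q)) ∈ u ×ˢ v)
  obtain ⟨p', hp', hpp'⟩ := mem_thickening_iff.1 hp
  refine mem_thickening_iff.2 ⟨(p', p'), mem_image_of_mem _ hp', max_lt ?_ ?_⟩
  · exact hpp'.trans (half_lt_self hδ)
  · linarith [dist_triangle_left q p' p]

theorem iUnion_mem_nhdsSet_diagonal {Y M : Type*} [TopologicalSpace Y] [PseudoMetricSpace M]
    {f : Y → X} {e : Y → M} (hf : Continuous f) (he : Continuous e) {U : X → Set X}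
    (hU : ∀ a, U a ∈ 𝓝 a) {δ : X → ℝ} (hδ : ∀ a, 0 < δ a) :
    (⋃ a, {z : Y × Y | f z.1 ∈ U a ∧ f z.2 ∈ U a ∧ dist (e z.1) (e z.2) < δ a}) ∈
      𝓝ˢ (diagonal Y) := by
  refine mem_nhdsSet_iff_forall.2 ?_
  rintro ⟨y, _⟩ (rfl : y = _)
  have hfst : ∀ᶠ z : Y × Y in 𝓝 (y, y), f z.1 ∈ U (f y) :=
    (hf.comp continuous_fst).continuousAt (hU (f y))
  have hsnd : ∀ᶠ z : Y × Y in 𝓝 (y, y), f z.2 ∈ U (f y) :=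
    (hf.comp continuous_snd).continuousAt (hU (f y))
  have hdist : ∀ᶠ z : Y × Y in 𝓝 (y, y), dist (e z.1) (e z.2) < δ (f y) :=
    ContinuousAt.eventually_lt (by fun_prop) continuousAt_const
      ((dist_self (e y)).trans_lt (hδ (f y)))
  exact mem_of_superset (hfst.and (hsnd.and hdist)) (subset_iUnion_of_subset (f y) Subset.rfl)

end UniformContinuity

namespace FiberwiseRetraction

section Combination

variable {X Y B : Type*} [TopologicalSpace X] [TopologicalSpace Y] [NormedAddCommGroup B]
  [NormedSpace ℝ B] {f : Y → X} {e : Y → B}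

/-- The combination of points of one fibre: the retraction onto that fibre, here the fibre of `x 0`,
of their affine combination in `B`. -/
def combination (r : FiberwiseRetraction f e) (n : ℕ) (x : Fin (n + 1) → Y)
    (t : Fin (n + 1) → ℝ) : Y :=
  r.toFun (f (x 0)) (∑ i, t i • e (x i))

theorem combination_congr (r : FiberwiseRetraction f e) {m n : ℕ} {x : Fin (m + 1) → Y}
    {y : Fin (n + 1) → Y} {t : Fin (m + 1) → ℝ} {s : Fin (n + 1) → ℝ} (hxy : f (x 0) = f (y 0))
    (hsum : ∑ i, t i • e (x i) = ∑ i, s i • e (y i)) :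
    r.combination m x t = r.combination n y s := by
  rw [combination, combination, hxy, hsum]

theorem combination_one (r : FiberwiseRetraction f e) (x : Fin 1 → Y) {t : Fin 1 → ℝ}
    (ht : t ∈ stdSimplex ℝ (Fin 1)) : r.combination 0 x t = x 0 := by
  have ht0 : t 0 = 1 := by simpa only [Fin.sum_univ_one] using ht.2
  have hsum : ∑ i : Fin 1, t i • e (x i) = e (x 0) := by rw [Fin.sum_univ_one, ht0, one_smul]
  exact (congrArg (r.toFun (f (x 0))) hsum).trans (r.apply_self (x 0))

theorem continuous_combination (r : FiberwiseRetraction f e) (n : ℕ) (x : Fin (n + 1) → Y) :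
    Continuous (r.combination n x) :=
  r.continuous_uncurry.comp (by fun_prop : Continuous fun t : Fin (n + 1) → ℝ =>
    (f (x 0), ∑ i, t i • e (x i)))

end Combination

section ConvexMetricStructure

variable {X Y B : Type*} [TopologicalSpace X] [PseudoMetricSpace Y] [NormedAddCommGroup B]
  [NormedSpace ℝ B] [CompleteSpace B] {f : Y → X} {e : Y → B}

theorem exists_dist_lt_near_fiber (r : FiberwiseRetraction f e) (hf : IsProperMap f)
    (he : Continuous e) (a : X) {ε : ℝ} (hε : 0 < ε) :
    ∃ U ∈ 𝓝 a, ∃ δ > 0, ∀ b ∈ U, ∀ c ∈ U, ∀ p ∈ convexHull ℝ (e '' (f ⁻¹' {b})), ∀ q,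
      dist p q < δ → dist (r.toFun b p) (r.toFun c q) < ε := by
  set C : Set B := convexHull ℝ (e '' (f ⁻¹' {a}))
  have hfiber : IsCompact (e '' (f ⁻¹' {a})) :=
    (hf.isCompact_preimage isCompact_singleton).image he
  have hcompact : IsCompact (closure C) :=
    (totallyBounded_convexHull.2 hfiber.totallyBounded).closure.isCompact_of_isClosed
      isClosed_closure
  obtain ⟨U, hU, δ, hδ, hUδ⟩ := exists_dist_lt_near_isCompact r.continuous_uncurry hcompact a hε
  have hnear : ∀ᶠ b in 𝓝 a, f ⁻¹' {b} ⊆ e ⁻¹' thickening δ C :=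
    upperHemicontinuousAt_iff_forall_isOpen.1
      (isClosedMap_iff_upperHemicontinuous.1 hf.isClosedMap a) _ (isOpen_thickening.preimage he)
      (image_subset_iff.1 ((subset_convexHull ℝ _).trans (self_subset_thickening hδ C)))
  refine ⟨_, inter_mem hU hnear, δ, hδ, fun b hb c hc p hp => hUδ b hb.1 c hc.1 p ?_⟩
  rw [thickening_closure]
  exact convexHull_min (image_subset_iff.2 hb.2) ((convex_convexHull ℝ _).thickening δ) hp

theorem exists_nhdsSet_diagonal_dist_combination_lt (r : FiberwiseRetraction f e)
    (hf : IsProperMap f) (he : Continuous e) {ε : ℝ} (hε : 0 < ε) :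
    ∃ V ∈ 𝓝ˢ (diagonal Y), ∀ (n : ℕ) (x y : Fin (n + 1) → Y), (∀ i j, f (x i) = f (x j)) →
      (∀ i j, f (y i) = f (y j)) → (∀ i, (x i, y i) ∈ V) → ∀ t ∈ stdSimplex ℝ (Fin (n + 1)),
        dist (r.combination n x t) (r.combination n y t) < ε := by
  choose U hU δ hδ hUδ using fun a => r.exists_dist_lt_near_fiber hf he a hε
  refine ⟨_, iUnion_mem_nhdsSet_diagonal hf.continuous he hU hδ, fun n x y hx hy hxy t ht => ?_⟩
  choose a hxa hya hdist using fun i => mem_iUnion.1 (hxy i)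
  obtain ⟨m, hm⟩ := Finite.exists_max fun i => δ (a i)
  have hhull : ∑ i, t i • e (x i) ∈ convexHull ℝ (e '' (f ⁻¹' {f (x m)})) :=
    (convex_convexHull ℝ _).sum_mem (fun i _ => ht.1 i) ht.2 fun i _ =>
      subset_convexHull ℝ _ (mem_image_of_mem e (hx i m))
  rw [combination, combination, hx 0 m, hy 0 m]
  exact hUδ (a m) _ (hxa m) _ (hya m) _ hhull _
    (dist_sum_smul_lt ht fun i => (hdist i).trans_le (hm i))

/-- The convex metric structure in which the admissible tuples are those contained in one fibre, and
their convex combinations are the ones induced by a fiberwise retraction. -/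
def toConvexMetricStructure (r : FiberwiseRetraction f e) (hf : IsProperMap f)
    (he : Continuous e) : ConvexMetricStructure Y where
  M _ := {x | ∀ i j, f (x i) = f (x j)}
  k := r.combination
  one_mem x i j := congrArg (f ∘ x) (Subsingleton.elim (α := Fin 1) i j)
  one_eq x _ _ ht := r.combination_one x ht
  face_mem _ _ hx _ _ _ := hx _ _
  face_eq _ x hx i t _ hi :=
    r.combination_congr (hx _ _) (sum_smul_removeNth (fun j => e (x j)) t i hi).symm
  merge_eq _ x hx i hi t _ :=
    r.combination_congr (hx _ _) (sum_smul_merge (fun j => e (x j)) t i (congrArg e hi)).symm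
  continuousOn_weights n x _ := (r.continuous_combination n x).continuousOn
  close _ hε := by
    obtain ⟨V, hV, h⟩ := r.exists_nhdsSet_diagonal_dist_combination_lt hf he hε
    exact ⟨V, hV, fun n x hx y hy => h n x y hx hy⟩

theorem isConvex_fiber (r : FiberwiseRetraction f e) (hf : IsProperMap f) (he : Continuous e)
    (a : X) : (r.toConvexMetricStructure hf he).IsConvex (f ⁻¹' {a}) := fun _ x hx =>
  ⟨fun i j => (hx i).trans (hx j).symm, fun _ _ => (r.map_apply (f (x 0)) _).trans (hx 0)⟩

end ConvexMetricStructure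

end FiberwiseRetraction

theorem corollary2p6_general {B X : Type*} [NormedAddCommGroup B] [NormedSpace ℝ B]
    [TopologicalSpace X] (Y : Set B) (f : Y → X) (hf : Continuous f) (α : ℝ) (hα : α < 1)
    (hcompact : ∀ x : X, IsCompact (f ⁻¹' {x}))
    (hpara : ∀ x : X, IsParaconvex α (Subtype.val '' (f ⁻¹' {x})))
    (hcont : HausdorffContinuous (fun x : X => (Subtype.val '' (f ⁻¹' {x}) : Set B))) :
    ∃ S : ConvexMetricStructure Y, ∀ x : X, S.IsConvex (f ⁻¹' {x}) := by
  let L : B →ₗᵢ[ℝ] Completion B := Completion.toComplₗᵢ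
  let e : Y → Completion B := fun y => L y
  have he : Isometry e := L.isometry.comp isometry_subtype_coe
  have himage : ∀ x, L '' (Subtype.val '' (f ⁻¹' {x})) = e '' (f ⁻¹' {x}) := fun x =>
    image_image L Subtype.val _
  have hcompact' : ∀ x, IsCompact (e '' (f ⁻¹' {x})) := fun x =>
    (hcompact x).image he.continuous
  let F : X → NonemptyCompacts (Completion B) := fun x =>
    ⟨⟨e '' (f ⁻¹' {x}), hcompact' x⟩, (hpara x).1.of_image.image e⟩
  have hFpara : ∀ x, IsParaconvex α (e '' (f ⁻¹' {x})) := fun x =>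
    himage x ▸ (hpara x).image_of_denseRange L Completion.denseRange_coe
      (himage x ▸ (hcompact' x).isClosed)
  have hcont' : HausdorffContinuous fun x => e '' (f ⁻¹' {x}) := by
    simpa only [himage] using hcont.image_isometry L.isometry
  have hF : Continuous F := hcont'.continuous_nonemptyCompacts
  have hproper : IsProperMap f :=
    isProperMap_of_continuous_fiber hf he.isUniformInducing.isInducing hF fun _ => rfl
  obtain ⟨r⟩ := exists_fiberwiseRetraction hα he.isEmbedding hF hFpara fun _ => rfl
  exact ⟨r.toConvexMetricStructure hproper he.continuous,
    r.isConvex_fiber hproper he.continuous⟩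

theorem corollary2p6 {B X : Type*} [NormedAddCommGroup B] [NormedSpace ℝ B] [CompleteSpace B]
    [TopologicalSpace X] (Y : Set B) (f : Y → X)
    (hf : Continuous f) (hsurj : Function.Surjective f)
    (α : ℝ) (hα0 : 0 ≤ α) (hα : α < 1 / 2)
    (hcompact : ∀ x : X, IsCompact (f ⁻¹' {x}))
    (hpara : ∀ x : X, IsParaconvex α (Subtype.val '' (f ⁻¹' {x})))
    (hcont : HausdorffContinuous (fun x : X => (Subtype.val '' (f ⁻¹' {x}) : Set B))) :
    ∃ S : ConvexMetricStructure Y, ∀ x : X, S.IsConvex (f ⁻¹' {x}) :=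
  corollary2p6_general Y f hf α (hα.trans one_half_lt_one) hcompact hpara hcont
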